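/- For a finite non-empty set $N$ in a metric space $(X,\rho)$, let $\operatorname{mst}(N)$ be the length of a minimal spanning tree of $N$, i.e. the least value of $\sum_{\{a,b\}\in E}\rho(a,b)$ over all connected graphs $(N,E)$ with vertex set $N$. For a finite set $M\subset X$ with at least two points let $$\operatorname{smt}(M)=\inf\{\operatorname{mst}(N) : N \text{ finite},\ M\subset N\subset X\},\qquad \operatorname{sr}(M)=\frac{\operatorname{smt}(M)}{\operatorname{mst}(M)},$$ and let the Steiner ratio of $X$ be $\operatorname{sr}(X,\rho)=\inf\{\operatorname{sr}(M) : M\subset X \text{ finite},\ |M|\ge 2\}$. Let $\rho_2$ denote the Euclidean metric on $\mathbb{R}^n$. **Assertion (Du–Smith).** Let $n\ge 3$ and let $M\subset\mathbb{R}^n$ be the vertex set of a regular $n$-dimensional simplex, i.e. $M$ consists of $n+1$ affinely independent points all of whose pairwise distances are equal. Then, with $\operatorname{smt}(M)$ taken in $(\mathbb{R}^n,\rho_2)$, $$\operatorname{sr}(M)>\operatorname{sr}(\mathbb{R}^n,\rho_2).$$ -/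

import Mathlib

namespace SteinerRatio

noncomputable section

/-- The length of a finite graph whose vertices are points of a metric space: the sum of the
distances between the endpoints of its edges. -/
def graphLength {X : Type*} [MetricSpace X] {N : Finset X} (G : SimpleGraph N) : ℝ :=
  ∑ e ∈ (Set.toFinite G.edgeSet).toFinset,
    Sym2.lift ⟨fun a b : N => dist (a : X) (b : X), fun a b => dist_comm (a : X) (b : X)⟩ e

/-- `mst N`: the least length of a connected graph with vertex set exactly `N` (a connected
spanning subgraph of the complete graph on `N`). For nonempty `N` this is the length of a
minimal spanning tree, as a minimum over a nonempty finite set of graphs. -/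
def mst {X : Type*} [MetricSpace X] (N : Finset X) : ℝ :=
  ⨅ G : {G : SimpleGraph N // G.Connected}, graphLength G.1

/-- `smt M`: the length of a shortest (Steiner minimal) tree connecting `M` in the ambient space
`X`, the infimum of `mst N` over all finite sets `N` with `M ⊆ N ⊆ X`. -/
def smt {X : Type*} [MetricSpace X] (M : Finset X) : ℝ :=
  ⨅ N : {N : Finset X // M ⊆ N}, mst N.1

/-- The Steiner ratio of a finite set `M` (with at least two points) in the metric space `X`. -/
def ratio {X : Type*} [MetricSpace X] (M : Finset X) : ℝ :=
  smt M / mst M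

/-- The Steiner ratio of the metric space `X`: the infimum of the Steiner ratios of all its finite
subsets with at least two points. -/
def spaceRatio (X : Type*) [MetricSpace X] : ℝ :=
  ⨅ M : {M : Finset X // 2 ≤ M.card}, ratio M.1

/-- The infimum of a family of lengths is taken over a set bounded below by `0`. -/
theorem graphLength_nonneg {X : Type*} [MetricSpace X] {N : Finset X} (G : SimpleGraph N) :
    0 ≤ graphLength G := by
  refine Finset.sum_nonneg fun e _ => ?_
  induction e with
  | _ a b => exact dist_nonneg

theorem mst_nonneg {X : Type*} [MetricSpace X] (N : Finset X) : 0 ≤ mst N :=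
  Real.iInf_nonneg fun G => graphLength_nonneg G.1

theorem smt_nonneg {X : Type*} [MetricSpace X] (M : Finset X) : 0 ≤ smt M :=
  Real.iInf_nonneg fun N => mst_nonneg N.1

theorem ratio_nonneg {X : Type*} [MetricSpace X] (M : Finset X) : 0 ≤ ratio M :=
  div_nonneg (smt_nonneg M) (mst_nonneg M)

end

end SteinerRatio

/-!
A set with a smaller Steiner ratio than that of a regular simplex with vertices `p i` and edge
length `s` is obtained by gluing the simplex to one of its translates at a common vertex.

Let `T` be a Steiner minimal network of the simplex and let `d i` be the direction of an edge of `T`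
at its terminal `p i`. There are at least four unit vectors `d i`, and `‖∑ d i‖² ≥ 0`, so two of
them satisfy `⟪d i, d j⟫ > -1/2` (`exists_ne_inner_gt`). Translate the simplex together with `T` by
`p j - p i`. The network and its translate meet at `p j` in two edges forming an angle of less than
`120°`, so their union is shortened strictly by a new branching point near `p j`
(`smt_lt_of_inner_gt`). On the other hand the two vertex sets have only `p j` in common, and all
distances in their union are at least `s` (`le_dist_add_sub`), so the length of the minimal spanning
tree is exactly doubled: it is the number of edges times `s`.

Instead of an actual minimal network only one nondegenerate edge at each terminal is needed
(`exists_edge_le_smt`). It comes from the Dreyfus–Wagner decomposition of a tree at a terminal `x`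
(`Buildable.exists_split`), proved by induction on the construction of the tree by attaching leaves,
and from the attainment of the optimal decomposition, which holds because `smt` is continuous in
each terminal and the distance from `x` to the branching point is coercive (`exists_split_le_smt`).
-/

namespace SteinerRatio

open scoped Classical in
/-- `Buildable N ℓ`: some tree with vertex set `N` has length `ℓ`, where trees are generated from a
single vertex by attaching leaves. -/
inductive Buildable {X : Type*} [MetricSpace X] : Finset X → ℝ → Prop
  | single (x : X) : Buildable {x} 0
  | leaf {N : Finset X} {ℓ : ℝ} (a b : X) (h : Buildable N ℓ) (ha : a ∈ N) (hb : b ∉ N) :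
      Buildable (insert b N) (ℓ + dist a b)

/-! ### Connected graphs and trees -/

section Graphs

variable {X Y : Type*} [MetricSpace X] [MetricSpace Y]

theorem graphLength_map_le {N : Finset X} {N' : Finset Y} (G : SimpleGraph N) (f : N ↪ N')
    (hf : ∀ a b : N, dist (f a : Y) (f b : Y) = dist (a : X) (b : X)) :
    graphLength (G.map f) ≤ graphLength G := by
  classical
  unfold graphLength
  have : (Set.toFinite (G.map f).edgeSet).toFinset
      = (Set.toFinite G.edgeSet).toFinset.map f.sym2Map := by
    ext e
    simp [SimpleGraph.edgeSet_map]
  rw [this, Finset.sum_map]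
  refine Finset.sum_le_sum fun e _ => ?_
  induction e with
  | _ a b => simp [hf]

theorem graphLength_sup_le {N : Finset X} (G H : SimpleGraph N) :
    graphLength (G ⊔ H) ≤ graphLength G + graphLength H := by
  classical
  unfold graphLength
  have : (Set.toFinite (G ⊔ H).edgeSet).toFinset
      = (Set.toFinite G.edgeSet).toFinset ∪ (Set.toFinite H.edgeSet).toFinset := by
    ext e
    simp
  rw [this, ← Finset.sum_union_inter]
  refine le_add_of_nonneg_right (Finset.sum_nonneg fun e _ => ?_)
  induction e with
  | _ a b => exact dist_nonneg

theorem mst_le {N : Finset X} {G : SimpleGraph N} (hG : G.Connected) : mst N ≤ graphLength G :=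
  ciInf_le ⟨0, by rintro _ ⟨H, rfl⟩; exact graphLength_nonneg H.1⟩
    (⟨G, hG⟩ : {G : SimpleGraph N // G.Connected})

theorem nonempty_connected {α : Type*} {N : Finset α} (hN : N.Nonempty) :
    Nonempty {G : SimpleGraph N // G.Connected} :=
  have := hN.to_subtype
  ⟨⟨⊤, SimpleGraph.connected_top⟩⟩

open scoped Classical in
theorem mst_union_le {N₁ N₂ : Finset X} (h : (N₁ ∩ N₂).Nonempty) :
    mst (N₁ ∪ N₂) ≤ mst N₁ + mst N₂ := by
  obtain ⟨c, hc⟩ := h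
  obtain ⟨hc₁, hc₂⟩ := Finset.mem_inter.1 hc
  have := nonempty_connected ⟨c, hc₁⟩
  have := nonempty_connected ⟨c, hc₂⟩
  refine le_ciInf_add_ciInf fun G₁ G₂ => ?_
  obtain ⟨G₁, h₁⟩ := G₁
  obtain ⟨G₂, h₂⟩ := G₂
  let f₁ : N₁ ↪ (N₁ ∪ N₂ : Finset X) :=
    ⟨fun a => ⟨a, Finset.mem_union_left _ a.2⟩, fun a b hab => Subtype.ext (congrArg Subtype.val hab :)⟩
  let f₂ : N₂ ↪ (N₁ ∪ N₂ : Finset X) :=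
    ⟨fun a => ⟨a, Finset.mem_union_right _ a.2⟩, fun a b hab => Subtype.ext (congrArg Subtype.val hab :)⟩
  have hconn : (G₁.map f₁ ⊔ G₂.map f₂).Connected := by
    let c' : (N₁ ∪ N₂ : Finset X) := ⟨c, Finset.mem_union_left _ hc₁⟩
    have key : ∀ a, (G₁.map f₁ ⊔ G₂.map f₂).Reachable a c' := by
      rintro ⟨a, ha⟩
      rcases Finset.mem_union.1 ha with h | h
      · exact ((h₁.preconnected ⟨a, h⟩ ⟨c, hc₁⟩).map
          (SimpleGraph.Embedding.map f₁ G₁).toHom).mono le_sup_left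
      · exact ((h₂.preconnected ⟨a, h⟩ ⟨c, hc₂⟩).map
          (SimpleGraph.Embedding.map f₂ G₂).toHom).mono le_sup_right
    have : Nonempty (N₁ ∪ N₂ : Finset X) := ⟨c'⟩
    exact ⟨fun a b => (key a).trans (key b).symm⟩
  calc mst (N₁ ∪ N₂) ≤ graphLength (G₁.map f₁ ⊔ G₂.map f₂) := mst_le hconn
    _ ≤ graphLength (G₁.map f₁) + graphLength (G₂.map f₂) := graphLength_sup_le _ _
    _ ≤ graphLength G₁ + graphLength G₂ :=
      add_le_add (graphLength_map_le _ _ fun _ _ => rfl) (graphLength_map_le _ _ fun _ _ => rfl)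

open scoped Classical in
theorem mst_image_le {f : X → Y} (hf : Isometry f) {N : Finset X} (hN : N.Nonempty) :
    mst (N.image f) ≤ mst N := by
  have := nonempty_connected hN
  refine le_ciInf fun G => ?_
  let g : N ↪ (N.image f : Finset Y) :=
    ⟨fun a => ⟨f a, Finset.mem_image_of_mem f a.2⟩, fun a b hab => Subtype.ext (hf.injective (congrArg Subtype.val hab))⟩
  have hsurj : Function.Surjective g := by
    rintro ⟨b, hb⟩
    obtain ⟨a, ha, rfl⟩ := Finset.mem_image.1 hb
    exact ⟨⟨a, ha⟩, rfl⟩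
  have hconn : (G.1.map g).Connected :=
    G.2.map (SimpleGraph.Embedding.map g G.1).toHom hsurj
  exact (mst_le hconn).trans (graphLength_map_le _ _ fun a b => hf.dist_eq a b)

theorem mst_singleton_le (x : X) : mst ({x} : Finset X) ≤ 0 := by
  have : Nonempty ({x} : Finset X) := ⟨⟨x, by simp⟩⟩
  refine (mst_le SimpleGraph.connected_top).trans (le_of_eq ?_)
  refine Finset.sum_eq_zero fun e he => ?_
  induction e with
  | _ a b =>
    have : a = b := Subtype.ext (by
      rw [Finset.mem_singleton.1 a.2, Finset.mem_singleton.1 b.2])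
    simp [this]

open scoped Classical in
theorem mst_pair_le (x y : X) : mst ({x, y} : Finset X) ≤ dist x y := by
  let x' : ({x, y} : Finset X) := ⟨x, by simp⟩
  let y' : ({x, y} : Finset X) := ⟨y, by simp⟩
  have hall : ∀ a : ({x, y} : Finset X), a = x' ∨ a = y' := by
    rintro ⟨a, ha⟩
    simpa [x', y'] using ha
  have : Nonempty ({x, y} : Finset X) := ⟨x'⟩
  refine (mst_le SimpleGraph.connected_top).trans ?_
  unfold graphLength
  have hsub : (Set.toFinite (⊤ : SimpleGraph ({x, y} : Finset X)).edgeSet).toFinset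
      ⊆ {s(x', y')} := by
    intro e he
    induction e with
    | _ a b =>
      have hab : a ≠ b := by simpa using he
      rcases hall a with rfl | rfl <;> rcases hall b with rfl | rfl <;> simp_all [Sym2.eq_swap]
  refine (Finset.sum_le_sum_of_subset_of_nonneg hsub fun e _ _ => ?_).trans (by simp [x', y'])
  induction e with
  | _ a b => exact dist_nonneg

/-- Every connected graph is at least as long as a tree with the same vertices, grown by attaching
one crossing edge after another. -/
theorem exists_buildable_le_graphLength {N : Finset X} {G : SimpleGraph N} (hG : G.Connected) :
    ∃ ℓ ≤ graphLength G, Buildable N ℓ := by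
  classical
  let len : Sym2 N → ℝ :=
    Sym2.lift ⟨fun a b : N => dist (a : X) (b : X), fun a b => dist_comm (a : X) (b : X)⟩
  have hlen : ∀ e, 0 ≤ len e := fun e => by
    induction e with
    | _ a b => exact dist_nonneg
  -- `E` collects the edges already used by the tree grown on the vertex set `S`.
  have grow : ∀ k, k + 1 ≤ N.card → ∃ (S : Finset N) (E : Finset (Sym2 N)) (ℓ : ℝ),
      S.card = k + 1 ∧ (∀ e ∈ E, e ∈ G.edgeSet ∧ ∀ v ∈ e, v ∈ S) ∧ ℓ = ∑ e ∈ E, len e ∧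
        Buildable (S.image Subtype.val) ℓ := by
    intro k
    induction k with
    | zero =>
      intro _
      obtain ⟨x⟩ := hG.nonempty
      exact ⟨{x}, ∅, 0, by simp, by simp, by simp, by simpa using Buildable.single (x : X)⟩
    | succ k ih =>
      intro hk
      obtain ⟨S, E, ℓ, hS, hE, hℓ, hB⟩ := ih (by omega)
      have hne : S.Nonempty := Finset.card_pos.1 (by omega)
      obtain ⟨u, hu⟩ := hne
      obtain ⟨v, hv⟩ : ∃ v, v ∉ S := by
        by_contra! h
        have h1 : S = Finset.univ := Finset.eq_univ_iff_forall.2 h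
        have h2 : S.card = N.card := by simp [h1]
        omega
      obtain ⟨w⟩ := hG.preconnected u v
      obtain ⟨d, -, hd₁, hd₂⟩ := w.exists_boundary_dart (S : Set N) (by simpa using hu)
        (by simpa using hv)
      simp only [Finset.mem_coe] at hd₁ hd₂
      have hnot : s(d.fst, d.snd) ∉ E := fun h => hd₂ ((hE _ h).2 _ (by simp))
      refine ⟨insert d.snd S, insert s(d.fst, d.snd) E, ℓ + dist (d.fst : X) d.snd, ?_, ?_, ?_, ?_⟩
      · rw [Finset.card_insert_of_notMem hd₂, hS]
      · intro e he
        rcases Finset.mem_insert.1 he with rfl | he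
        · refine ⟨d.adj, fun v hv => ?_⟩
          rcases Sym2.mem_iff.1 hv with rfl | rfl
          · exact Finset.mem_insert_of_mem hd₁
          · exact Finset.mem_insert_self _ _
        · exact ⟨(hE e he).1, fun v hv => Finset.mem_insert_of_mem ((hE e he).2 v hv)⟩
      · rw [Finset.sum_insert hnot, hℓ, add_comm]
        rfl
      · rw [Finset.image_insert]
        refine Buildable.leaf _ _ hB (Finset.mem_image_of_mem _ hd₁) ?_
        simpa using hd₂
  have hpos : 0 < N.card := by
    obtain ⟨x⟩ := hG.nonempty
    exact Finset.card_pos.2 ⟨x, x.2⟩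
  obtain ⟨S, E, ℓ, hS, hE, hℓ, hB⟩ := grow (N.card - 1) (by omega)
  have hSuniv : S = Finset.univ := Finset.eq_univ_of_card _ (by simp [hS]; omega)
  refine ⟨ℓ, ?_, ?_⟩
  · rw [hℓ]
    exact Finset.sum_le_sum_of_subset_of_nonneg (fun e he => by simpa using (hE e he).1)
      fun e _ _ => hlen e
  · convert hB
    subst hSuniv
    ext x
    simp

theorem Buildable.nonneg {N : Finset X} {ℓ : ℝ} (h : Buildable N ℓ) : 0 ≤ ℓ := by
  induction h with
  | single => rfl
  | leaf a b _ _ _ ih => exact add_nonneg ih dist_nonneg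

theorem Buildable.dist_le {N : Finset X} {ℓ : ℝ} (h : Buildable N ℓ) :
    ∀ a ∈ N, ∀ b ∈ N, dist a b ≤ ℓ := by
  classical
  induction h with
  | single x => simp
  | @leaf N ℓ a b h ha hb ih =>
    intro c hc d hd
    have hab : 0 ≤ dist a b := dist_nonneg
    rcases Finset.mem_insert.1 hc with rfl | hc' <;>
      rcases Finset.mem_insert.1 hd with rfl | hd'
    · simpa using add_nonneg h.nonneg hab
    · linarith [ih a ha d hd', dist_triangle c a d, dist_comm c a]
    · linarith [ih c hc' a ha, dist_triangle c a d]
    · linarith [ih c hc' d hd']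

theorem Buildable.mul_card_le {N : Finset X} {ℓ s : ℝ} (h : Buildable N ℓ)
    (hs : ∀ a ∈ N, ∀ b ∈ N, a ≠ b → s ≤ dist a b) : s * (N.card - 1) ≤ ℓ := by
  classical
  induction h with
  | single x => simp
  | @leaf N ℓ a b h ha hb ih =>
    have h1 := ih fun a ha b hb => hs a (Finset.mem_insert_of_mem ha) b (Finset.mem_insert_of_mem hb)
    have h2 := hs a (Finset.mem_insert_of_mem ha) b (Finset.mem_insert_self _ _)
      (fun h => hb (h ▸ ha))
    rw [Finset.card_insert_of_notMem hb]
    push_cast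
    linarith

theorem le_mst {N : Finset X} (hN : N.Nonempty) {c : ℝ} (h : ∀ ℓ, Buildable N ℓ → c ≤ ℓ) :
    c ≤ mst N := by
  have := nonempty_connected hN
  refine le_ciInf fun G => ?_
  obtain ⟨ℓ, hℓ, hB⟩ := exists_buildable_le_graphLength G.2
  exact (h ℓ hB).trans hℓ

open scoped Classical in
theorem mst_insert_le {N : Finset X} {a : X} (b : X) (ha : a ∈ N) :
    mst (insert b N) ≤ mst N + dist a b := by
  have h : insert b N = N ∪ {a, b} := by
    ext x
    simp only [Finset.mem_union, Finset.mem_insert, Finset.mem_singleton]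
    refine ⟨by tauto, ?_⟩
    rintro (h | rfl | h)
    exacts [Or.inr h, Or.inr ha, Or.inl h]
  have h' : mst (N ∪ {a, b}) ≤ mst N + mst {a, b} := mst_union_le ⟨a, by simp [ha]⟩
  rw [h]
  linarith [mst_pair_le a b]

theorem Buildable.mst_le {N : Finset X} {ℓ : ℝ} (h : Buildable N ℓ) : mst N ≤ ℓ := by
  classical
  induction h with
  | single x => exact mst_singleton_le x
  | leaf a b h ha hb ih => linarith [mst_insert_le b ha]

theorem mst_le_mul_card {N : Finset X} {s : ℝ} (hN : N.Nonempty)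
    (hs : ∀ a ∈ N, ∀ b ∈ N, a ≠ b → dist a b = s) : mst N ≤ s * (N.card - 1) := by
  classical
  induction hN using Finset.Nonempty.cons_induction with
  | singleton a => simpa using mst_singleton_le a
  | cons b N hb hN ih =>
    obtain ⟨a, ha⟩ := hN
    have h1 := ih fun a ha b hb => hs a (Finset.mem_cons_of_mem ha) b (Finset.mem_cons_of_mem hb)
    have h2 := hs a (Finset.mem_cons_of_mem ha) b (Finset.mem_cons_self _ _)
      (fun h => hb (h ▸ ha))
    rw [Finset.card_cons, Finset.cons_eq_insert]
    push_cast
    linarith [mst_insert_le b ha]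

end Graphs

/-! ### Steiner networks and their decomposition -/

section Smt

variable {X Y : Type*} [MetricSpace X] [MetricSpace Y]

theorem smt_le_mst {M N : Finset X} (h : M ⊆ N) : smt M ≤ mst N :=
  ciInf_le ⟨0, by rintro _ ⟨N, rfl⟩; exact mst_nonneg N.1⟩ (⟨N, h⟩ : {N : Finset X // M ⊆ N})

theorem nonempty_superset {α : Type*} (M : Finset α) : Nonempty {N : Finset α // M ⊆ N} :=
  ⟨⟨M, Finset.Subset.refl M⟩⟩

theorem smt_mono {M M' : Finset X} (h : M ⊆ M') : smt M ≤ smt M' :=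
  have := nonempty_superset M'
  le_ciInf fun N => smt_le_mst (h.trans N.2)

theorem le_smt {M : Finset X} (hM : M.Nonempty) {c : ℝ}
    (h : ∀ N ℓ, M ⊆ N → Buildable N ℓ → c ≤ ℓ) : c ≤ smt M :=
  have := nonempty_superset M
  le_ciInf fun N => le_mst (hM.mono N.2) fun ℓ => h N.1 ℓ N.2

open scoped Classical in
theorem smt_union_le {M₁ M₂ : Finset X} (c : X) (h₁ : c ∈ M₁) (h₂ : c ∈ M₂) :
    smt (M₁ ∪ M₂) ≤ smt M₁ + smt M₂ := by
  have := nonempty_superset M₁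
  have := nonempty_superset M₂
  exact le_ciInf_add_ciInf fun N₁ N₂ =>
    (smt_le_mst (Finset.union_subset_union N₁.2 N₂.2)).trans
      (mst_union_le ⟨c, Finset.mem_inter.2 ⟨N₁.2 h₁, N₂.2 h₂⟩⟩)

theorem smt_singleton (x : X) : smt ({x} : Finset X) = 0 :=
  le_antisymm ((smt_le_mst (Finset.Subset.refl _)).trans (mst_singleton_le x)) (smt_nonneg _)

open scoped Classical in
theorem smt_pair_le (x y : X) : smt ({x, y} : Finset X) ≤ dist x y :=
  (smt_le_mst (Finset.Subset.refl _)).trans (mst_pair_le x y)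

theorem dist_le_smt {M : Finset X} {x y : X} (hx : x ∈ M) (hy : y ∈ M) : dist x y ≤ smt M :=
  le_smt ⟨x, hx⟩ fun _ _ hN hB => hB.dist_le x (hN hx) y (hN hy)

/-- A network for `M` becomes one for `M ∪ {y}`, hence for every `M' ⊆ M ∪ {y}`, by joining `y` to a
terminal `x` by a segment. -/
theorem smt_le_smt_add_dist {M M' : Finset X} {x y : X} (hx : x ∈ M)
    (h : ∀ z ∈ M', z = y ∨ z ∈ M) : smt M' ≤ smt M + dist x y := by
  classical
  have h1 : M' ⊆ M ∪ {x, y} := fun z hz => by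
    rcases h z hz with rfl | h <;> simp [*]
  linarith [smt_mono h1, smt_union_le (M₁ := M) (M₂ := {x, y}) x hx (by simp), smt_pair_le x y]

open scoped Classical in
theorem smt_image_le {f : X → Y} (hf : Isometry f) {M : Finset X} (hM : M.Nonempty) :
    smt (M.image f) ≤ smt M :=
  have := nonempty_superset M
  le_ciInf fun N => (smt_le_mst (Finset.image_subset_image N.2)).trans
    (mst_image_le hf (hM.mono N.2))

open scoped Classical in
theorem continuous_smt_insert (A : Finset X) : Continuous fun x => smt (insert x A) := by
  refine (LipschitzWith.of_le_add fun x y => ?_).continuous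
  rw [dist_comm]
  refine smt_le_smt_add_dist (Finset.mem_insert_self y A) fun z hz => ?_
  rcases Finset.mem_insert.1 hz with h | h <;> simp [h]

open scoped Classical in
/-- The Dreyfus–Wagner decomposition: a tree through `x` and at least two further terminals `A`
contains a (possibly trivial) path from `x` to a point `y` at which the terminals separate into two
nonempty classes `B` and `A \ B`. -/
theorem Buildable.exists_split {N : Finset X} {ℓ : ℝ} (h : Buildable N ℓ) :
    ∀ x ∈ N, ∀ A ⊆ N, x ∉ A → 2 ≤ A.card → ∃ y, ∃ B ⊆ A, B.Nonempty ∧ (A \ B).Nonempty ∧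
      dist x y + smt (insert y B) + smt (insert y (A \ B)) ≤ ℓ := by
  induction h with
  | single z =>
    intro x _ A hA _ hcard
    have := Finset.card_le_card hA
    simp at this
    omega
  | @leaf N ℓ a b h ha hb ih =>
    intro x hx A hA hxA hcard
    have hsmt : ∀ A' ⊆ N, smt A' ≤ ℓ := fun A' hA' => (smt_le_mst hA').trans h.mst_le
    have hab : 0 ≤ dist a b := dist_nonneg
    have hcompl : ∀ z ∈ A, insert z (A \ {z}) = A := fun z hz => by
      rw [Finset.sdiff_singleton_eq_erase, Finset.insert_erase hz]
    have hdiff : ∀ z, (A \ {z}).Nonempty := fun z => by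
      rw [← Finset.card_pos]
      have := Finset.le_card_sdiff {z} A
      simp only [Finset.card_singleton] at this
      omega
    rcases Finset.mem_insert.1 hx with rfl | hx
    · have hAN : A ⊆ N := (Finset.subset_insert_iff_of_notMem hxA).1 hA
      by_cases haA : a ∈ A
      · refine ⟨a, {a}, by simpa using haA, by simp, hdiff a, ?_⟩
        rw [hcompl a haA, Finset.insert_eq_of_mem (Finset.mem_singleton_self a), smt_singleton,
          dist_comm]
        linarith [hsmt A hAN]
      · obtain ⟨y, B, hB, h1, h2, h3⟩ := ih a ha A hAN haA hcard
        exact ⟨y, B, hB, h1, h2, by linarith [dist_triangle x a y, dist_comm x a]⟩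
    by_cases hbA : b ∉ A
    · obtain ⟨y, B, hB, h1, h2, h3⟩ :=
        ih x hx A ((Finset.subset_insert_iff_of_notMem hbA).1 hA) hxA hcard
      exact ⟨y, B, hB, h1, h2, by linarith⟩
    push Not at hbA
    have hxb : x ≠ b := fun h => hb (h ▸ hx)
    have hmem : ∀ z ∈ A, z ≠ b → z ∈ N := fun z hz hzb =>
      (Finset.mem_insert.1 (hA hz)).resolve_left hzb
    by_cases hax : a = x
    · subst hax
      refine ⟨a, {b}, by simpa using hbA, by simp, hdiff b, ?_⟩
      have h1 : smt (insert a (A \ {b})) ≤ ℓ := hsmt _ fun z hz => by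
        rcases Finset.mem_insert.1 hz with rfl | hz
        · exact ha
        · simp only [Finset.mem_sdiff, Finset.mem_singleton] at hz
          exact hmem z hz.1 hz.2
      rw [dist_self]
      linarith [smt_pair_le a b]
    -- The terminal `b` is replaced by its neighbour `a`.
    let A' := insert a (A.erase b)
    have hA' : ∀ z, z ∈ A' ↔ z = a ∨ (z ≠ b ∧ z ∈ A) := by simp [A']
    by_cases hcard' : 2 ≤ A'.card
    · obtain ⟨y, B, hB, h1, h2, h3⟩ := ih x hx A' (fun z hz => by
          rcases (hA' z).1 hz with rfl | hz
          exacts [ha, hmem z hz.2 hz.1]) (fun h => by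
          rcases (hA' x).1 h with h | h
          exacts [hax h.symm, hxA h.2]) hcard'
      have hbB : b ∉ B := fun h => by
        rcases (hA' b).1 (hB h) with h | h
        exacts [hb (h ▸ ha), h.1 rfl]
      by_cases haB : a ∈ B
      · have hsd : ∀ z, z ∈ A' \ B ↔ z ∈ A \ (A.filter fun z => z ∈ B ∨ z = b) := fun z => by
          simp only [Finset.mem_sdiff, hA', Finset.mem_filter]
          by_cases hza : z = a
          · subst hza; tauto
          · tauto
        refine ⟨y, A.filter fun z => z ∈ B ∨ z = b, Finset.filter_subset _ _, ⟨b, by simp [hbA]⟩,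
          ?_, ?_⟩
        · obtain ⟨z, hz⟩ := h2
          exact ⟨z, (hsd z).1 hz⟩
        · have h4 : smt (insert y (A.filter fun z => z ∈ B ∨ z = b))
              ≤ smt (insert y B) + dist a b :=
            smt_le_smt_add_dist (Finset.mem_insert_of_mem haB) fun z hz => by
              simp only [Finset.mem_insert, Finset.mem_filter] at hz ⊢
              tauto
          rw [← Finset.ext hsd]
          linarith
      · have hBA : B ⊆ A := fun z hz => by
          rcases (hA' z).1 (hB hz) with rfl | h
          exacts [(haB hz).elim, h.2]
        refine ⟨y, B, hBA, h1, ⟨b, by simp [hbA, hbB]⟩, ?_⟩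
        have h4 : smt (insert y (A \ B)) ≤ smt (insert y (A' \ B)) + dist a b :=
          smt_le_smt_add_dist (x := a) (by simp [hA', haB]) fun z hz => by
            simp only [Finset.mem_insert, Finset.mem_sdiff, hA'] at hz ⊢
            tauto
        linarith
    · -- Here the terminals are just `a` and `b`.
      have hsub : ∀ z ∈ A, z = a ∨ z = b := fun z hz => by
        by_contra! hne
        refine hcard' (Finset.one_lt_card.2 ⟨z, (hA' z).2 (Or.inr ⟨hne.2, hz⟩), a,
          (hA' a).2 (Or.inl rfl), hne.1⟩)
      have haA : a ∈ A := by
        obtain ⟨z, hz⟩ := hdiff b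
        simp only [Finset.mem_sdiff, Finset.mem_singleton] at hz
        exact (hsub z hz.1).resolve_right hz.2 ▸ hz.1
      refine ⟨a, {a}, by simpa using haA, by simp, hdiff a, ?_⟩
      have h1 : smt A ≤ smt {a, b} := smt_mono fun z hz => by simpa using hsub z hz
      rw [hcompl a haA, Finset.insert_eq_of_mem (Finset.mem_singleton_self a), smt_singleton]
      linarith [smt_pair_le a b, h.dist_le x hx a ha]

end Smt

/-! ### Edges of Steiner minimal networks at a terminal -/

section Branch

variable {X : Type*} [MetricSpace X] [ProperSpace X]

open scoped Classical in
/-- In a proper space the best decomposition of a Steiner network at the terminal `x` is attained: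
the function `y ↦ |xy| + smt (B ∪ y) + smt (A \ B ∪ y)` is continuous and coercive. -/
theorem exists_split_le_smt {A : Finset X} {x : X} (hxA : x ∉ A) (hA : 2 ≤ A.card) :
    ∃ y, ∃ B ⊆ A, B.Nonempty ∧ (A \ B).Nonempty ∧
      dist x y + smt (insert y B) + smt (insert y (A \ B)) ≤ smt (insert x A) := by
  let g : Finset X → X → ℝ := fun B y =>
    dist x y + smt (insert y B) + smt (insert y (A \ B))
  have hmin : ∀ B, ∃ y, ∀ z, g B y ≤ g B z := fun B => by
    have : Nonempty X := ⟨x⟩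
    refine Continuous.exists_forall_le ?_ ?_
    · exact ((continuous_const.dist continuous_id).add (continuous_smt_insert B)).add
        (continuous_smt_insert (A \ B))
    · refine Filter.tendsto_atTop_mono (fun y => ?_) (tendsto_dist_left_cocompact_atTop x)
      linarith [smt_nonneg (insert y B), smt_nonneg (insert y (A \ B))]
  choose Y hY using hmin
  let P := A.powerset.filter fun B => B.Nonempty ∧ (A \ B).Nonempty
  have hP : P.Nonempty := by
    obtain ⟨a, ha, b, hb, hab⟩ := Finset.one_lt_card.1 hA
    exact ⟨{a}, by simpa [P, ha] using ⟨b, by simp [hb, hab.symm]⟩⟩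
  obtain ⟨B, hBP, hB⟩ := Finset.exists_min_image P (fun B => g B (Y B)) hP
  simp only [P, Finset.mem_filter, Finset.mem_powerset] at hBP hB
  refine ⟨Y B, B, hBP.1, hBP.2.1, hBP.2.2, le_smt ⟨x, Finset.mem_insert_self _ _⟩ ?_⟩
  intro N ℓ hN h
  obtain ⟨y, B', h1, h2, h3, h4⟩ := h.exists_split x (hN (Finset.mem_insert_self _ _)) A
    ((Finset.subset_insert _ _).trans hN) hxA hA
  exact ((hB B' ⟨h1, h2, h3⟩).trans (hY B' y)).trans h4

open scoped Classical in
/-- A Steiner minimal network of `insert x A` has a nondegenerate edge `xy` at its terminal `x`;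
the terminals `B` are reached through this edge, and the terminals `C` through others. -/
theorem exists_edge_le_smt {A : Finset X} {x : X} (hxA : x ∉ A) (hA : A.Nonempty) :
    ∃ y, y ≠ x ∧ ∃ B C, A ⊆ B ∪ C ∧
      dist x y + smt (insert y B) + smt (insert x C) ≤ smt (insert x A) := by
  induction A using Finset.strongInduction with
  | H A ih =>
    by_cases hcard : 2 ≤ A.card
    · obtain ⟨y, B, hB, h1, h2, h3⟩ := exists_split_le_smt hxA hcard
      by_cases hyx : y = x
      · subst hyx
        obtain ⟨z, hz, B', C', h4, h5⟩ := ih B (lt_of_le_of_ne hB (by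
          rintro rfl; simp at h2)) (fun h => hxA (hB h)) h1
        refine ⟨z, hz, B', C' ∪ (A \ B), fun w hw => ?_, ?_⟩
        · by_cases hwB : w ∈ B
          · have := h4 hwB
            simp only [Finset.mem_union] at this ⊢
            tauto
          · simp [hw, hwB]
        · have h6 := smt_union_le (M₁ := insert y C') (M₂ := insert y (A \ B)) y (by simp) (by simp)
          rw [← Finset.insert_union_distrib] at h6
          rw [dist_self] at h3
          linarith
      · refine ⟨y, hyx, A, ∅, by simp, ?_⟩
        have h4 := smt_union_le (M₁ := insert y B) (M₂ := insert y (A \ B)) y (by simp) (by simp)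
        rw [← Finset.insert_union_distrib, Finset.union_sdiff_of_subset hB] at h4
        rw [insert_empty_eq, smt_singleton]
        linarith
    · obtain ⟨a, rfl⟩ := Finset.card_eq_one.1 (show A.card = 1 by
        have := hA.card_pos
        omega)
      have hax : a ≠ x := fun h => hxA (by simp [h])
      refine ⟨a, hax, {a}, ∅, by simp, ?_⟩
      rw [insert_empty_eq, smt_singleton, Finset.insert_eq_of_mem (Finset.mem_singleton_self a),
        smt_singleton]
      linarith [dist_le_smt (M := {x, a}) (x := x) (y := a) (by simp) (by simp)]

end Branch

/-! ### Angles and simplices in Euclidean space -/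

section Euclidean

variable {V : Type*} [NormedAddCommGroup V] [InnerProductSpace ℝ V]

open scoped RealInnerProductSpace

/-- Among at least four unit vectors, two make an angle of less than `120°`: otherwise the sum of
all of them would have negative squared norm. -/
theorem exists_ne_inner_gt {ι : Type*} [Fintype ι] (hι : 4 ≤ Fintype.card ι) (d : ι → V)
    (hd : ∀ i, ‖d i‖ = 1) : ∃ i j, i ≠ j ∧ -(1 / 2) < ⟪d i, d j⟫ := by
  classical
  by_contra! h
  have h1 : (0 : ℝ) ≤ ⟪∑ i, d i, ∑ j, d j⟫ := real_inner_self_nonneg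
  have h2 : ∀ i j, ⟪d i, d j⟫ ≤ (if i = j then (3 / 2 : ℝ) else 0) - 1 / 2 := fun i j => by
    by_cases hij : i = j
    · subst hij
      rw [real_inner_self_eq_norm_sq, hd]
      norm_num
    · simpa [hij] using h i j hij
  have h3 : ⟪∑ i, d i, ∑ j, d j⟫ ≤ (Fintype.card ι : ℝ) * (3 / 2 - Fintype.card ι / 2) := by
    simp_rw [sum_inner, inner_sum]
    refine (Finset.sum_le_sum fun i _ => Finset.sum_le_sum fun j _ => h2 i j).trans_eq ?_
    simp [Finset.sum_sub_distrib]
    ring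
  have h4 : (4 : ℝ) ≤ Fintype.card ι := by exact_mod_cast hι
  nlinarith

/-- Two unit vectors at an angle of less than `120°`: the star joining the origin and both of them
to a suitable multiple of their sum is shorter than `2`. -/
theorem exists_norm_add_lt_two {d e : V} (hd : ‖d‖ = 1) (he : ‖e‖ = 1) (h : -(1 / 2) < ⟪d, e⟫) :
    ∃ x : V, ‖x‖ + ‖d - x‖ + ‖e - x‖ < 2 := by
  set r := ‖d + e‖ with hr
  have hr2 : r ^ 2 = 2 + 2 * ⟪d, e⟫ := by
    rw [hr, norm_add_sq_real, hd, he]; ring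
  have hr1 : 1 < r := by nlinarith [norm_nonneg (d + e)]
  -- The star with centre `t • (d + e)` turns out no longer than `2 - t * r * (r - 1 - t * r)`.
  obtain ⟨t, ht, htr⟩ : ∃ t : ℝ, 0 < t ∧ t * r < r - 1 :=
    ⟨(r - 1) / (2 * r), by apply div_pos <;> linarith, by field_simp; linarith⟩
  have hsq : ∀ u : V, ‖u‖ = 1 → ⟪u, d + e⟫ = r ^ 2 / 2 →
      ‖u - t • (d + e)‖ ≤ 1 - t * r ^ 2 / 2 + t ^ 2 * r ^ 2 / 2 := fun u hu hin => by
    have h1 : ‖u - t • (d + e)‖ ^ 2 = 1 - t * r ^ 2 + t ^ 2 * r ^ 2 := by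
      rw [norm_sub_sq_real, hu, real_inner_smul_right, hin, norm_smul, Real.norm_of_nonneg ht.le,
        ← hr]
      ring
    -- `v ≤ (1 + v ^ 2) / 2`
    nlinarith [sq_nonneg (‖u - t • (d + e)‖ - 1)]
  refine ⟨t • (d + e), ?_⟩
  have h1 := hsq d hd (by rw [inner_add_right, real_inner_self_eq_norm_sq, hd, hr2]; ring)
  have h2 := hsq e he (by
    rw [inner_add_right, real_inner_self_eq_norm_sq, he, hr2, real_inner_comm]; ring)
  rw [norm_smul, Real.norm_of_nonneg ht.le, ← hr]
  have h3 : 0 < t * r * (r - 1 - t * r) := by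
    apply mul_pos (mul_pos ht (by linarith)); linarith
  nlinarith

/-- Two segments leaving `p` at an angle of less than `120°` can be replaced by a shorter star. -/
theorem exists_dist_add_dist_add_dist_lt {p y z : V} (hy : y ≠ p) (hz : z ≠ p)
    (h : -(1 / 2) < ⟪(‖y - p‖)⁻¹ • (y - p), (‖z - p‖)⁻¹ • (z - p)⟫) :
    ∃ x, dist p x + dist x y + dist x z < dist p y + dist p z := by
  have hunit : ∀ w, w ≠ p → ‖(‖w - p‖)⁻¹ • (w - p)‖ = 1 := fun w hw => by
    rw [norm_smul, norm_inv, norm_norm, inv_mul_cancel₀ (norm_ne_zero_iff.2 (sub_ne_zero.2 hw))]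
  obtain ⟨x, hx⟩ := exists_norm_add_lt_two (hunit y hy) (hunit z hz) h
  -- Both segments are first cut at the same distance `l` from `p`.
  set l := min ‖y - p‖ ‖z - p‖
  have hl : 0 < l := lt_min (norm_pos_iff.2 (sub_ne_zero.2 hy)) (norm_pos_iff.2 (sub_ne_zero.2 hz))
  have hseg : ∀ w, w ≠ p → l ≤ ‖w - p‖ →
      dist (p + l • x) w ≤ l * ‖(‖w - p‖)⁻¹ • (w - p) - x‖ + (‖w - p‖ - l) := fun w hw hlw => by
    have hw0 : ‖w - p‖ ≠ 0 := norm_ne_zero_iff.2 (sub_ne_zero.2 hw)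
    set d := (‖w - p‖)⁻¹ • (w - p) with hd
    have h1 : w - p = ‖w - p‖ • d := by rw [hd, smul_smul, mul_inv_cancel₀ hw0, one_smul]
    have h2 : w - (p + l • x) = l • (d - x) + (‖w - p‖ - l) • d := by
      rw [sub_smul, ← h1, smul_sub]; abel
    rw [dist_comm, dist_eq_norm, h2]
    refine (norm_add_le _ _).trans (le_of_eq ?_)
    rw [norm_smul, norm_smul, Real.norm_of_nonneg hl.le, Real.norm_of_nonneg (sub_nonneg.2 hlw),
      hd, hunit w hw, mul_one]
  refine ⟨p + l • x, ?_⟩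
  have h1 := hseg y hy (min_le_left _ _)
  have h2 := hseg z hz (min_le_right _ _)
  have h3 : dist p (p + l • x) = l * ‖x‖ := by
    rw [dist_self_add_right, norm_smul, Real.norm_of_nonneg hl.le]
  rw [h3, dist_eq_norm' p y, dist_eq_norm' p z]
  nlinarith

/-- The points of a regular simplex and its translate taking the vertex `p i` to the vertex `p j`
have mutual distances at least the edge length, apart from the common vertex. -/
theorem le_dist_add_sub {ι : Type*} {p : ι → V} {s : ℝ}
    (hp : ∀ a b, a ≠ b → dist (p a) (p b) = s) {i j k : ι} (hij : i ≠ j) (hk : k ≠ i) (l : ι) :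
    s ≤ dist (p k + (p j - p i)) (p l) := by
  classical
  have hsq : ∀ a b, ‖p a - p b‖ ^ 2 = if a = b then 0 else s ^ 2 := fun a b => by
    split_ifs with h
    · simp [h]
    · rw [← dist_eq_norm, hp a b h]
  have hid : ∀ a b c d : V, ‖a + (b - c) - d‖ ^ 2 = ‖a - c‖ ^ 2 + ‖a - d‖ ^ 2 + ‖b - c‖ ^ 2
      + ‖b - d‖ ^ 2 - ‖a - b‖ ^ 2 - ‖c - d‖ ^ 2 := fun a b c d => by
    simp only [← real_inner_self_eq_norm_sq, inner_add_left, inner_add_right, inner_sub_left,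
      inner_sub_right, real_inner_comm a, real_inner_comm b c, real_inner_comm b d,
      real_inner_comm c d]
    ring
  rw [dist_eq_norm]
  refine le_of_sq_le_sq ?_ (norm_nonneg _)
  rw [hid]
  simp only [hsq]
  have := sq_nonneg s
  rw [if_neg hk, if_neg hij.symm]
  by_cases hkl : k = l
  · subst hkl
    rw [if_pos rfl, if_neg (Ne.symm hk)]
    by_cases hjk : j = k
    · simp [hjk]
    · simp [hjk, Ne.symm hjk]
  · rw [if_neg hkl]
    split_ifs <;> linarith

end Euclidean

/-! ### Two simplices with a common vertex -/

section Simplex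

variable {V : Type*} [NormedAddCommGroup V] [InnerProductSpace ℝ V]

open scoped RealInnerProductSpace Classical in
/-- Two networks with edges `xy` and `x'y'` at terminals `x`, `x'`: if `x'` is translated to `x` and
the edges then make an angle of less than `120°`, the union of the networks can be shortened. -/
theorem smt_lt_of_inner_gt {M N B C B' C' : Finset V} {x x' y y' : V} {m : ℝ}
    (hy : y ≠ x) (hy' : y' ≠ x')
    (hm : dist x y + smt (insert y B) + smt (insert x C) ≤ m)
    (hm' : dist x' y' + smt (insert y' B') + smt (insert x' C') ≤ m)
    (hM : M ⊆ insert x (B ∪ C))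
    (hN : N ⊆ B' ∪ C')
    (h : -(1 / 2) < ⟪(‖y - x‖)⁻¹ • (y - x), (‖y' - x'‖)⁻¹ • (y' - x')⟫) :
    smt (M ∪ N.image (· + (x - x'))) < 2 * m := by
  let f : V → V := (· + (x - x'))
  have hf : Isometry f := isometry_add_right _
  have hfx : f x' = x := by simp [f]
  have hsub : f y' - x = y' - x' := by simp only [f]; abel
  -- The edges from `x` to `y` and to `f y'` are replaced by a star with centre `z`.
  obtain ⟨z, hz⟩ := exists_dist_add_dist_add_dist_lt (z := f y') hy
    (fun h => hy' (hf.injective (h.trans hfx.symm))) (by rwa [hsub])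
  have h1 := smt_union_le (M₁ := {x, z}) (M₂ := {z, y}) z (by simp) (by simp)
  have h2 := smt_union_le (M₁ := {x, z} ∪ {z, y}) (M₂ := {z, f y'}) z (by simp) (by simp)
  have h3 := smt_union_le (M₁ := {x, z} ∪ {z, y} ∪ {z, f y'}) (M₂ := insert y B) y
    (by simp) (by simp)
  have h4 := smt_union_le (M₁ := {x, z} ∪ {z, y} ∪ {z, f y'} ∪ insert y B) (M₂ := insert x C) x
    (by simp) (by simp)
  have h5 := smt_union_le (M₁ := {x, z} ∪ {z, y} ∪ {z, f y'} ∪ insert y B ∪ insert x C)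
    (M₂ := (insert y' B').image f) (f y') (by simp) (by simp)
  have h6 := smt_union_le (M₁ := {x, z} ∪ {z, y} ∪ {z, f y'} ∪ insert y B ∪ insert x C ∪
    (insert y' B').image f) (M₂ := (insert x' C').image f) x (by simp) (by simp [hfx])
  have h7 : M ∪ N.image f ⊆ {x, z} ∪ {z, y} ∪ {z, f y'} ∪ insert y B ∪ insert x C ∪
      (insert y' B').image f ∪ (insert x' C').image f := by
    intro w hw
    rcases Finset.mem_union.1 hw with hw | hw
    · have := hM hw
      simp only [Finset.mem_union, Finset.mem_insert] at this ⊢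
      tauto
    · obtain ⟨v, hv, rfl⟩ := Finset.mem_image.1 hw
      rcases Finset.mem_union.1 (hN hv) with hv | hv
      · exact Finset.mem_union_left _ (Finset.mem_union_right _
          (Finset.mem_image_of_mem f (Finset.mem_insert_of_mem hv)))
      · exact Finset.mem_union_right _
          (Finset.mem_image_of_mem f (Finset.mem_insert_of_mem hv))
  have h8 := smt_image_le hf (M := insert y' B') (by simp)
  have h9 := smt_image_le hf (M := insert x' C') (by simp)
  have h10 : dist x (f y') = dist x' y' := by rw [← hfx, hf.dist_eq]
  have h11 := smt_mono h7
  change smt (M ∪ N.image f) < 2 * m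
  linarith [smt_pair_le x z, smt_pair_le z y, smt_pair_le z (f y')]

/-- The union of a regular simplex and a suitable translate sharing one vertex with it has a smaller
Steiner ratio than the simplex. -/
theorem exists_ratio_lt [ProperSpace V] {ι : Type*} [Fintype ι] (hι : 4 ≤ Fintype.card ι)
    {p : ι → V} {s : ℝ} (hs : 0 < s) (hp : ∀ a b, a ≠ b → dist (p a) (p b) = s) {M : Finset V}
    (hM : (M : Set V) = Set.range p) : ∃ N : Finset V, 2 ≤ N.card ∧ ratio N < ratio M := by
  classical
  have hinj : Function.Injective p := fun a b hab => by
    by_contra hne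
    have := hp a b hne
    rw [hab, dist_self] at this
    exact hs.ne this
  have hmem : ∀ i, p i ∈ M := fun i => by
    rw [← Finset.mem_coe, hM]; exact ⟨i, rfl⟩
  have hrange : ∀ v ∈ M, ∃ i, p i = v := fun v hv => by
    rw [← Finset.mem_coe, hM] at hv; exact hv
  have hcard : M.card = Fintype.card ι := by
    have : M = Finset.univ.image p := by
      rw [← Finset.coe_inj, hM]; simp
    rw [this, Finset.card_image_of_injective _ hinj, Finset.card_univ]
  have hedge : ∀ i, ∃ y, y ≠ p i ∧ ∃ B C, M.erase (p i) ⊆ B ∪ C ∧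
      dist (p i) y + smt (insert y B) + smt (insert (p i) C) ≤ smt M := fun i => by
    have h := exists_edge_le_smt (Finset.notMem_erase (p i) M) (by
      rw [← Finset.card_pos, Finset.card_erase_of_mem (hmem i)]; omega)
    rwa [Finset.insert_erase (hmem i)] at h
  choose y hy B C hBC hlen using hedge
  obtain ⟨i, j, hij, hin⟩ := exists_ne_inner_gt hι (fun i => (‖y i - p i‖)⁻¹ • (y i - p i))
    fun i => by
      rw [norm_smul, norm_inv, norm_norm,
        inv_mul_cancel₀ (norm_ne_zero_iff.2 (sub_ne_zero.2 (hy i)))]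
  let f : V → V := (· + (p j - p i))
  have hf : Isometry f := isometry_add_right _
  let N := M ∪ (M.erase (p i)).image f
  have hlt : smt N < 2 * smt M :=
    smt_lt_of_inner_gt (hy j) (hy i) (hlen j) (hlen i)
      (by rw [← Finset.erase_subset_iff_of_mem (Finset.mem_insert_self _ _)]
          exact (hBC j).trans (Finset.subset_insert _ _))
      (hBC i) (by rw [real_inner_comm]; exact hin)
  have hfar : ∀ v ∈ (M.erase (p i)).image f, ∀ w ∈ M, s ≤ dist v w := by
    intro v hv w hw
    obtain ⟨u, hu, rfl⟩ := Finset.mem_image.1 hv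
    obtain ⟨hui, hu⟩ := Finset.mem_erase.1 hu
    obtain ⟨k, rfl⟩ := hrange u hu
    obtain ⟨l, rfl⟩ := hrange w hw
    exact le_dist_add_sub hp hij (fun h => hui (by rw [h])) l
  have hsep : ∀ v ∈ M, ∀ w ∈ M, v ≠ w → dist v w = s := by
    intro v hv w hw hvw
    obtain ⟨k, rfl⟩ := hrange v hv
    obtain ⟨l, rfl⟩ := hrange w hw
    exact hp k l fun h => hvw (by rw [h])
  have hNcard : N.card = 2 * M.card - 1 := by
    have hdisj : Disjoint M ((M.erase (p i)).image f) :=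
      Finset.disjoint_left.2 fun v hv hv' => by
        have := hfar v hv' v hv
        rw [dist_self] at this
        linarith
    rw [Finset.card_union_of_disjoint hdisj, Finset.card_image_of_injective _ hf.injective,
      Finset.card_erase_of_mem (hmem i)]
    omega
  have hNsep : ∀ v ∈ N, ∀ w ∈ N, v ≠ w → s ≤ dist v w := by
    intro v hv w hw hvw
    rcases Finset.mem_union.1 hv with hv | hv <;> rcases Finset.mem_union.1 hw with hw | hw
    · exact (hsep v hv w hw hvw).ge
    · rw [dist_comm]; exact hfar w hw v hv
    · exact hfar v hv w hw
    · obtain ⟨v, hv', rfl⟩ := Finset.mem_image.1 hv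
      obtain ⟨w, hw', rfl⟩ := Finset.mem_image.1 hw
      rw [hf.dist_eq]
      exact (hsep v (Finset.mem_of_mem_erase hv') w (Finset.mem_of_mem_erase hw')
        fun h => hvw (by rw [h])).ge
  have hMne : M.Nonempty := ⟨p i, hmem i⟩
  have hNne : N.Nonempty := hMne.mono Finset.subset_union_left
  have hM4 : (4 : ℝ) ≤ M.card := by rw [hcard]; exact_mod_cast hι
  have hNcard' : (N.card : ℝ) - 1 = 2 * (M.card - 1) := by
    rw [hNcard, Nat.cast_sub (by omega)]
    push_cast
    ring
  have hmstM : mst M ≤ s * (M.card - 1) := mst_le_mul_card hMne hsep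
  have hmstM' : s * (M.card - 1) ≤ mst M :=
    le_mst hMne fun ℓ h => h.mul_card_le fun v hv w hw hvw => (hsep v hv w hw hvw).ge
  have hmstN : s * (2 * (M.card - 1)) ≤ mst N := by
    rw [← hNcard']
    exact le_mst hNne fun ℓ h => h.mul_card_le hNsep
  have hK : 0 < s * ((M.card : ℝ) - 1) := mul_pos hs (by linarith)
  refine ⟨N, by omega, ?_⟩
  unfold ratio
  rw [div_lt_div_iff₀ (by linarith) (by linarith)]
  calc smt N * mst M ≤ smt N * (s * (M.card - 1)) :=
        mul_le_mul_of_nonneg_left hmstM (smt_nonneg _)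
    _ < 2 * smt M * (s * (M.card - 1)) := mul_lt_mul_of_pos_right hlt hK
    _ = smt M * (s * (2 * (M.card - 1))) := by ring
    _ ≤ smt M * mst N := mul_le_mul_of_nonneg_left hmstN (smt_nonneg _)

end Simplex

end SteinerRatio

/-- For `n ≥ 3`, the vertex set of a regular `n`-dimensional simplex (an affinely independent
family of `n + 1` points with all pairwise distances equal) in Euclidean space `ℝⁿ` has Steiner
ratio strictly greater than the Steiner ratio of `ℝⁿ`. -/
theorem mainTheorem5 (n : ℕ) (hn : 3 ≤ n)
    (s : Affine.Simplex ℝ (EuclideanSpace ℝ (Fin n)) n) (hs : s.Equilateral)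
    (M : Finset (EuclideanSpace ℝ (Fin n)))
    (hM : (M : Set (EuclideanSpace ℝ (Fin n))) = Set.range s.points) :
    SteinerRatio.spaceRatio (EuclideanSpace ℝ (Fin n)) < SteinerRatio.ratio M := by
  obtain ⟨r, hr⟩ := hs
  have h01 : (⟨0, by omega⟩ : Fin (n + 1)) ≠ ⟨1, by omega⟩ := by simp
  have hr0 : 0 < r := by
    rw [← hr _ _ h01]
    exact dist_pos.2 (s.independent.injective.ne h01)
  obtain ⟨N, hN, hlt⟩ :=
    SteinerRatio.exists_ratio_lt (by simpa using hn) hr0 (fun a b hab => hr a b hab) hM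
  refine lt_of_le_of_lt ?_ hlt
  exact ciInf_le ⟨0, by rintro _ ⟨N, rfl⟩; exact SteinerRatio.ratio_nonneg N.1⟩
    (⟨N, hN⟩ : {M : Finset (EuclideanSpace ℝ (Fin n)) // 2 ≤ M.card})
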